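/- Let $f:[0,\infty)\times\mathbb R^n\times U\to\mathbb R^n$ and $g:[0,\infty)\times\mathbb R^n\times V\to\mathbb R^n$ with $U,V\subseteq\mathbb R^m$, and put $F(t,x)=f(t,x,U)$, $G(t,x)=g(t,x,V)$. Assume that $F$ and $G$ have compact, path-connected (in particular nonempty) values and are Lipschitz in $(t,x)$ with respect to the Hausdorff distance on $[0,T]\times\mathbb R^n$ for every $T>0$. Let $\delta=\max_{u\in U}\|u\|$ exist, and let $\sup_{v\in V}\inf_{u\in U}\|u-v\|\le\varepsilon$ (this holds in particular if $d_{\mathrm H}(U,V)\le\varepsilon$). Here $\|\cdot\|$ is the Euclidean norm and $d_{\mathrm H}$ the Hausdorff distance. Let $0\le t_0<t_f$ and $\kappa\ge 0$, let $X_0\subseteq\mathbb R^n$ be nonempty, compact and path-connected, and let $\bar X_0\subseteq\mathbb R^n$ be nonempty, closed and connected with $d_{\mathrm H}(X_0,\bar X_0)\le\kappa$. A trajectory of $F$ is a locally absolutely continuous $x:[t_0,\infty)\to\mathbb R^n$ with $\dot x(t)\in F(t,x(t))$ for a.e. $t\ge t_0$, and $\mathbb X_t(F,X_0)$ is the set of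 all $x(t)$ for trajectories $x$ of $F$ with $x(t_0)\in X_0$; likewise for $G$ and $\bar X_0$. For $i=1,\dots,n$ let $a_i,b_i:[t_0,t_f]\to(0,\infty)$ be continuous, and let $w_i:[0,\infty)^2\to[0,\infty)$ be continuous, nondecreasing in each argument, and positive on $(0,\infty)\times[0,\infty)$. Assume that for every trajectory $x$ of $F$ with $x(t_0)\in X_0$ and every trajectory $y$ of $G$ with $y(t_0)\in\bar X_0$ and $\|x(t_0)-y(t_0)\|\le\kappa$, and for all $t\in[t_0,t_f]$, $u\in U$, $v\in V$ and $i$, $$|f_i(t,x(t),u)-g_i(t,y(t),v)|\le a_i(t)\,w_i(|x_i(t)-y_i(t)|,\|u-v\|)+b_i(t).$$ Fix $r_{0,i}>0$, let $G_i(r)=\int_{r_{0,i}}^r \frac{ds}{w_i(s,2\delta+\varepsilon)}$ for $r>0$, and let $$\eta_i(t,2\delta+\varepsilon,\kappa)=G_i^{-1}\Big[G_i\Big(\kappa+\int_{t_0}^t b_i(\tau)\,d\tau\Big)+\int_{t_0}^t a_i(\tau)\,d\tau\Big],\qquad \eta_i(t_0,2\delta+\varepsilon,\kappa)=\kappa ,$$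 where it is assumed that for $t=t_f$ the argument in square brackets lies in the domain $G_i((0,\infty))$ of $G_i^{-1}$, for every $i$. Let $\eta=(\eta_1,\dots,\eta_n)$, and let $\preceq$ and $|\cdot|$ on $\mathbb R^n$ be componentwise. Then: (i) For each $x_0\in X_0$ there are $y_0\in\bar X_0$ with $\|x_0-y_0\|\le\kappa$, a trajectory $x$ of $F$ with $x(t_0)=x_0$, and a trajectory $y$ of $G$ with $y(t_0)=y_0$, such that $|x(t)-y(t)|\preceq\eta(t,2\delta+\varepsilon,\kappa)$ for all $t\in[t_0,t_f]$. (ii) For all $t\in[t_0,t_f]$, $d_{\mathrm R}[\mathbb X_t(G,\bar X_0),\mathbb X_t(F,X_0)]\preceq\eta(t_f,2\delta+\varepsilon,\kappa)$, where the hyperrectangular distance $d_{\mathrm R}$ has the components $$d_{\mathrm R,i}(A,B)=\max\Big\{\sup_{x\in A}\inf_{y\in B}|x_i-y_i|,\ \sup_{y\in B}\inf_{x\in A}|x_i-y_i|\Big\}.$$ (iii) For all $t\in[t_0,t_f]$, $$\mathbb X_t(G,\bar X_0)\subseteq\bigcup_{x\in\mathbb X_t(F,X_0)}\Big(\{x\}\oplus\prod_{i=1}^n[-\eta_i(t_f,2\delta+\varepsilon,\kappa),\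 \eta_i(t_f,2\delta+\varepsilon,\kappa)]\Big).$$ -/

import Mathlib

open MeasureTheory

noncomputable section

namespace Reach

/-- Real Euclidean space of dimension `n`. -/
abbrev Euc (n : ℕ) : Type := EuclideanSpace ℝ (Fin n)

/-- The multifunction `F(t, x) = f(t, x, U)` generated by dynamics `f` and a control set `U`. -/
def velocitySet {n m : ℕ} (f : ℝ → Euc n → Euc m → Euc n) (U : Set (Euc m)) :
    ℝ → Euc n → Set (Euc n) :=
  fun t x => f t x '' U

/-- Standing conditions on a multifunction `F : [0, ∞) × ℝⁿ ⇉ ℝⁿ`: its values are compact and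
path-connected (in particular nonempty), and it is Lipschitz in time and state with respect to the
Hausdorff distance. The Lipschitz constant may depend on the time horizon `T`, which is weaker than
asking for one constant on all of `[0, ∞) × ℝⁿ`. Continuity of `F` is a consequence. -/
structure IsRegularMultifunction {n : ℕ} (F : ℝ → Euc n → Set (Euc n)) : Prop where
  isCompact : ∀ t, 0 ≤ t → ∀ x, IsCompact (F t x)
  isPathConnected : ∀ t, 0 ≤ t → ∀ x, IsPathConnected (F t x)
  lipschitz : ∀ T : ℝ, ∃ L : ℝ, ∀ s ∈ Set.Icc 0 T, ∀ t ∈ Set.Icc 0 T, ∀ x y : Euc n,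
    Metric.hausdorffDist (F s x) (F t y) ≤ L * (|s - t| + ‖x - y‖)

/-- `x` is a (Caratheodory) solution on `[t₀, ∞)` of the differential inclusion `x' ∈ F(t, x)`:
it is the integral of a locally integrable velocity `v` with `v(t) ∈ F(t, x(t))` for almost every
`t ≥ t₀`. Values of `x` at times before `t₀` are irrelevant. -/
def IsTrajectory {n : ℕ} (F : ℝ → Euc n → Set (Euc n)) (t₀ : ℝ) (x : ℝ → Euc n) : Prop :=
  ∃ v : ℝ → Euc n,
    (∀ t, t₀ ≤ t → IntervalIntegrable v volume t₀ t) ∧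
    (∀ t, t₀ ≤ t → x t = x t₀ + ∫ s in t₀..t, v s) ∧
    ∀ᵐ s ∂(volume.restrict (Set.Ici t₀)), v s ∈ F s (x s)

/-- The forward reachable set at time `t` from the set of states `X₀` at time `t₀`. -/
def reachableSet {n : ℕ} (F : ℝ → Euc n → Set (Euc n)) (t₀ : ℝ) (X₀ : Set (Euc n)) (t : ℝ) :
    Set (Euc n) :=
  {p | ∃ x : ℝ → Euc n, IsTrajectory F t₀ x ∧ x t₀ ∈ X₀ ∧ x t = p}

/-- Hyperrectangular fattening of `X` by `ρ`: the union over `x ∈ X` of the boxes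
`{x} ⊕ ∏ i, [-ρ i, ρ i]`. -/
def boxFattening {n : ℕ} (X : Set (Euc n)) (ρ : Fin n → ℝ) : Set (Euc n) :=
  ⋃ x ∈ X, {z | ∀ i, z i - x i ∈ Set.Icc (-(ρ i)) (ρ i)}

/-- `h_i(x, B)`, the distance from `x i` to the projection of `B` on the `i`-th axis; it is `∞` when
`B` is empty, and the infimum is a minimum when `B` is compact and nonempty. -/
def axisDist {n : ℕ} (i : Fin n) (x : Euc n) (B : Set (Euc n)) : ENNReal :=
  ⨅ y ∈ B, ENNReal.ofReal |x i - y i|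

/-- The `i`-th component of the hyperrectangular distance between `A` and `B`. -/
def boxDist {n : ℕ} (A B : Set (Euc n)) (i : Fin n) : ENNReal :=
  max (⨆ x ∈ A, axisDist i x B) (⨆ y ∈ B, axisDist i y A)

/-- Regularity of the growth functions on `[t₀, t_f]`: `a i`, `b i` are continuous and positive, and
`w i` is continuous on `[0, ∞)²`, nondecreasing in both arguments, and positive (it may vanish
where its first argument is `0`, as in the linear case `w i s r = s`). -/
structure IsGrowthData {n : ℕ} (t₀ tf : ℝ) (a b : Fin n → ℝ → ℝ) (w : Fin n → ℝ → ℝ → ℝ) :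
    Prop where
  continuousOn_a : ∀ i, ContinuousOn (a i) (Set.Icc t₀ tf)
  pos_a : ∀ i, ∀ t ∈ Set.Icc t₀ tf, 0 < a i t
  continuousOn_b : ∀ i, ContinuousOn (b i) (Set.Icc t₀ tf)
  pos_b : ∀ i, ∀ t ∈ Set.Icc t₀ tf, 0 < b i t
  continuousOn_w : ∀ i,
    ContinuousOn (fun p : ℝ × ℝ => w i p.1 p.2) (Set.Ici 0 ×ˢ Set.Ici 0)
  mono_w : ∀ i, ∀ s s' r r' : ℝ, 0 ≤ s → s ≤ s' → 0 ≤ r → r ≤ r' → w i s r ≤ w i s' r'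
  pos_w : ∀ i, ∀ s r : ℝ, 0 < s → 0 ≤ r → 0 < w i s r

/-- `(a_i, b_i, w_i)`-bounded growth on `[t₀, t_f]` of the deviation dynamics
`f(t, x(t), u) - g(t, y(t), v)`, along every nominal trajectory `x` from `X₀` and every off-nominal
trajectory `y` from `Y₀` whose initial states are at most `κ` apart, for all control values. -/
def HasBoundedDeviationGrowth {n m : ℕ} (f g : ℝ → Euc n → Euc m → Euc n) (U V : Set (Euc m))
    (X₀ Y₀ : Set (Euc n)) (t₀ tf κ : ℝ) (a b : Fin n → ℝ → ℝ) (w : Fin n → ℝ → ℝ → ℝ) : Prop :=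
  ∀ x y : ℝ → Euc n,
    IsTrajectory (velocitySet f U) t₀ x → x t₀ ∈ X₀ →
    IsTrajectory (velocitySet g V) t₀ y → y t₀ ∈ Y₀ →
    ‖x t₀ - y t₀‖ ≤ κ →
    ∀ t ∈ Set.Icc t₀ tf, ∀ u ∈ U, ∀ v ∈ V, ∀ i : Fin n,
      |f t (x t) u i - g t (y t) v i| ≤ a i t * w i |x t i - y t i| ‖u - v‖ + b i t

/-- `G(r) = ∫ s in r₀..r, 1 / ω(s)`, for `r > 0`. -/
def bihariG (ω : ℝ → ℝ) (r₀ r : ℝ) : ℝ :=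
  ∫ s in r₀..r, 1 / ω s

/-- The inverse of `G : (0, ∞) → ℝ`; meaningful on its domain `G((0, ∞))`. -/
def bihariGInv (ω : ℝ → ℝ) (r₀ : ℝ) : ℝ → ℝ :=
  Function.invFunOn (bihariG ω r₀) (Set.Ioi 0)

/-- The argument `G(κ + ∫ b) + ∫ a` of `G⁻¹` in the deviation bound, integrals over `[t₀, t]`. -/
def bihariArg (ω a b : ℝ → ℝ) (r₀ t₀ t κ : ℝ) : ℝ :=
  bihariG ω r₀ (κ + ∫ τ in t₀..t, b τ) + ∫ τ in t₀..t, a τ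

/-- The deviation bound `η_i(t, ε, κ) = G_i⁻¹[G_i(κ + ∫ b_i) + ∫ a_i]` with `ω = w_i(·, ε)` in
`G_i`. At `t = t₀` both integrals vanish and the formula reads `G_i⁻¹[G_i(κ)] = κ`; this value is
written out since for `κ = 0` the point `κ` is not in the domain `(0, ∞)` of `G_i`. -/
def eta {n : ℕ} (a b : Fin n → ℝ → ℝ) (w : Fin n → ℝ → ℝ → ℝ) (r₀ : Fin n → ℝ) (t₀ : ℝ)
    (t ε κ : ℝ) (i : Fin n) : ℝ :=
  if t = t₀ then κ
  else bihariGInv (fun s => w i s ε) (r₀ i)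
    (bihariArg (fun s => w i s ε) (a i) (b i) (r₀ i) t₀ t κ)

end Reach

end

/-! Growth is assumed for all control values at once, and any `u ∈ U`, `v ∈ V` satisfy `‖u - v‖ ≤ 2δ
+ ε`, by passing through a point of `U` near `v`. Hence every trajectory pair with `κ`-close initial
states obeys the bound, and no trajectory has to be selected to follow another (`abs_sub_le_eta`).
Componentwise, `φ = |x_i - y_i|` satisfies `φ(t) ≤ κ + ∫ (a_i w_i(φ, 2δ + ε) + b_i)`, and the
Bihari-LaSalle inequality `bihariG_le_of_le_integral` gives `φ ≤ η_i`. Since `η_i(t) ≤ η_i(t_f)`,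
the assertions on reachable sets follow once each point of one initial set is paired with a
`κ`-close point of the other.

It remains to know that a trajectory starts at every state (`exists_trajectory`). The values are not
convex, so weak limits of velocities would not do. Instead each Euler step takes as its new velocity
a point of the next value nearest to the old velocity. The Lipschitz condition then makes the
discrete velocities Lipschitz in time uniformly in the step size, so they converge pointwise along
an ultrafilter, and closedness of the values keeps the limit in `F`. -/

open Filter Topology Set

namespace Reach

/-! ### Existence of trajectories without convexity -/

section Existence

variable {n : ℕ}

theorem IsRegularMultifunction.hausdorffEDist_ne_top {F : ℝ → Euc n → Set (Euc n)}
    (hF : IsRegularMultifunction F) {s t : ℝ} (hs : 0 ≤ s) (ht : 0 ≤ t) (x y : Euc n) :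
    Metric.hausdorffEDist (F s x) (F t y) ≠ ⊤ :=
  Metric.hausdorffEDist_ne_top_of_nonempty_of_bounded (hF.isPathConnected s hs x).nonempty
    (hF.isPathConnected t ht y).nonempty (hF.isCompact s hs x).isBounded
    (hF.isCompact t ht y).isBounded

theorem IsRegularMultifunction.exists_near {F : ℝ → Euc n → Set (Euc n)}
    (hF : IsRegularMultifunction F) {s t : ℝ} (hs : 0 ≤ s) (ht : 0 ≤ t) (x y : Euc n)
    {v : Euc n} (hv : v ∈ F s x) :
    ∃ v' ∈ F t y, ‖v' - v‖ ≤ Metric.hausdorffDist (F s x) (F t y) := by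
  obtain ⟨v', hv', h⟩ := (hF.isCompact t ht y).exists_infDist_eq_dist
    (hF.isPathConnected t ht y).nonempty v
  refine ⟨v', hv', ?_⟩
  rw [← dist_eq_norm, dist_comm, ← h]
  exact Metric.infDist_le_hausdorffDist_of_mem hv (hF.hausdorffEDist_ne_top hs ht x y)

/-- Euler polygons whose velocities are successive nearest points. -/
theorem IsRegularMultifunction.exists_euler {F : ℝ → Euc n → Set (Euc n)}
    (hF : IsRegularMultifunction F) {t₀ h : ℝ} (ht₀ : 0 ≤ t₀) (hh : 0 < h) {x₀ v₀ : Euc n}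
    (hv₀ : v₀ ∈ F t₀ x₀) :
    ∃ x v : ℕ → Euc n, x 0 = x₀ ∧ v 0 = v₀ ∧ (∀ k, x (k + 1) = x k + h • v k) ∧
      (∀ k : ℕ, v k ∈ F (t₀ + k * h) (x k)) ∧
      ∀ k : ℕ, ‖v (k + 1) - v k‖ ≤ Metric.hausdorffDist (F (t₀ + k * h) (x k))
        (F (t₀ + (k + 1 : ℕ) * h) (x (k + 1))) := by
  have hpos : ∀ k : ℕ, 0 ≤ t₀ + k * h := fun k => by positivity
  -- Membership is a premise under the existential, so that `next` is total and the recursion can be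
  -- defined before membership is proved along it.
  have hnext : ∀ (k : ℕ) (x v : Euc n), ∃ v' : Euc n, v ∈ F (t₀ + k * h) x →
      v' ∈ F (t₀ + (k + 1 : ℕ) * h) (x + h • v) ∧
      ‖v' - v‖ ≤ Metric.hausdorffDist (F (t₀ + k * h) x)
        (F (t₀ + (k + 1 : ℕ) * h) (x + h • v)) := by
    intro k x v
    by_cases hv : v ∈ F (t₀ + k * h) x
    · obtain ⟨v', h1, h2⟩ := hF.exists_near (hpos k) (hpos (k + 1)) x (x + h • v) hv
      exact ⟨v', fun _ => ⟨h1, h2⟩⟩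
    · exact ⟨0, fun h' => absurd h' hv⟩
  choose next hnext using hnext
  let p : ℕ → Euc n × Euc n := fun k =>
    Nat.rec (x₀, v₀) (fun k q => (q.1 + h • q.2, next k q.1 q.2)) k
  have hmem : ∀ k : ℕ, (p k).2 ∈ F (t₀ + k * h) (p k).1 := by
    intro k
    induction k with
    | zero => simpa [p] using hv₀
    | succ k ih => exact (hnext k _ _ ih).1
  exact ⟨fun k => (p k).1, fun k => (p k).2, rfl, rfl, fun k => rfl, hmem,
    fun k => (hnext k _ _ (hmem k)).2⟩

theorem norm_sub_le_of_norm_succ_sub_le {v : ℕ → Euc n} {c : ℝ} {K : ℕ}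
    (hv : ∀ k < K, ‖v (k + 1) - v k‖ ≤ c) {i j : ℕ} (hij : i ≤ j) (hj : j ≤ K) :
    ‖v j - v i‖ ≤ (j - i) * c := by
  induction j, hij using Nat.le_induction with
  | base => simp
  | succ j hij ih =>
    have h1 := ih (by omega)
    have h2 := hv j (by omega)
    have h3 : v (j + 1) - v i = (v (j + 1) - v j) + (v j - v i) := by abel
    rw [h3]
    refine (norm_add_le _ _).trans ?_
    push_cast
    linarith

/-- A velocity jump is at most `L * h * (1 + ‖v k‖)`, so `1 + ‖v k‖` grows by a factor of at most `1
+ L * h ≤ exp (L * h)` per step. For the quadratic estimate with elapsed time `d`, one more step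
adds `h • (v j - v i)`, of norm at most `L * M * d * h`, and `d ^ 2 + d * h ≤ (d + h) ^ 2`. The
constants depend on the horizon `S` but not on `h`. -/
theorem euler_bounds {x v : ℕ → Euc n} {h L : ℝ} {K : ℕ} (hh : 0 < h) (hL : 0 ≤ L)
    (hx : ∀ k, x (k + 1) = x k + h • v k)
    (hv : ∀ k < K, ‖v (k + 1) - v k‖ ≤ L * (h + ‖x k - x (k + 1)‖)) {S M : ℝ} (hS : K * h ≤ S)
    (hM : M = (1 + ‖v 0‖) * Real.exp (L * S)) :
    (∀ k ≤ K, ‖v k‖ ≤ M) ∧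
    (∀ i j, i ≤ j → j ≤ K → ‖v j - v i‖ ≤ L * M * (j * h - i * h)) ∧
    (∀ i j, i ≤ j → j ≤ K →
      ‖x j - x i - (j * h - i * h) • v i‖ ≤ L * M * (j * h - i * h) ^ 2) ∧
    ∀ k ≤ K, ‖x k - x 0‖ ≤ M * S := by
  have hstep : ∀ k < K, ‖v (k + 1) - v k‖ ≤ L * h * (1 + ‖v k‖) := by
    intro k hk
    refine (hv k hk).trans_eq ?_
    rw [hx k, sub_add_cancel_left, norm_neg, norm_smul, Real.norm_of_nonneg hh.le]
    ring
  have hexp : ∀ k ≤ K, 1 + ‖v k‖ ≤ (1 + ‖v 0‖) * Real.exp (L * (k * h)) := by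
    intro k
    induction k with
    | zero => simp
    | succ k ih =>
      intro hk
      have h1 := ih (by omega)
      have h2 := hstep k (by omega)
      have h3 : ‖v (k + 1)‖ ≤ ‖v (k + 1) - v k‖ + ‖v k‖ := by
        simpa using norm_add_le (v (k + 1) - v k) (v k)
      have h4 : 1 + L * h ≤ Real.exp (L * h) := by linarith [Real.add_one_le_exp (L * h)]
      have h5 : Real.exp (L * ((k + 1 : ℕ) * h)) = Real.exp (L * (k * h)) * Real.exp (L * h) := by
        rw [← Real.exp_add]; congr 1; push_cast; ring
      calc 1 + ‖v (k + 1)‖ ≤ (1 + ‖v k‖) * (1 + L * h) := by linarith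
        _ ≤ ((1 + ‖v 0‖) * Real.exp (L * (k * h))) * Real.exp (L * h) :=
          mul_le_mul h1 h4 (by positivity) (by positivity)
        _ = _ := by rw [h5]; ring
  have hvM1 : ∀ k ≤ K, 1 + ‖v k‖ ≤ M := by
    intro k hk
    refine (hexp k hk).trans ?_
    rw [hM]
    have : (k : ℝ) * h ≤ S := le_trans (by gcongr) hS
    gcongr
  have hvM : ∀ k ≤ K, ‖v k‖ ≤ M := fun k hk => by linarith [hvM1 k hk]
  have hM0 : 0 ≤ M := (norm_nonneg _).trans (hvM 0 (Nat.zero_le _))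
  have hlip : ∀ i j, i ≤ j → j ≤ K → ‖v j - v i‖ ≤ L * M * (j * h - i * h) := by
    intro i j hij hj
    have := norm_sub_le_of_norm_succ_sub_le (c := L * h * M) (fun k hk =>
      (hstep k hk).trans (by gcongr; exact hvM1 k hk.le)) hij hj
    linarith
  refine ⟨hvM, hlip, ?_, ?_⟩
  · intro i j hij
    induction j, hij using Nat.le_induction with
    | base => intro _; simp
    | succ j hij ih =>
      intro hj
      have h1 := ih (by omega)
      have h2 := hlip i j hij (by omega)
      have h3 : x (j + 1) - x i - (((j + 1 : ℕ) : ℝ) * h - i * h) • v i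
          = (x j - x i - ((j : ℝ) * h - i * h) • v i) + h • (v j - v i) := by
        rw [hx j]; push_cast; module
      have h4 : ‖h • (v j - v i)‖ ≤ h * (L * M * (j * h - i * h)) := by
        rw [norm_smul, Real.norm_of_nonneg hh.le]; gcongr
      have h5 : (0 : ℝ) ≤ j * h - i * h := by
        have : (i : ℝ) ≤ j := by exact_mod_cast hij
        nlinarith
      have h6 : 0 ≤ L * M := by positivity
      rw [h3]
      refine (norm_add_le _ _).trans ?_
      push_cast
      nlinarith [mul_nonneg h6 (mul_nonneg h5 hh.le), mul_nonneg h6 (sq_nonneg h)]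
  · intro k hk
    have := norm_sub_le_of_norm_succ_sub_le (v := x) (c := h * M) (K := K) (fun k hk => by
      rw [hx k, add_sub_cancel_left, norm_smul, Real.norm_of_nonneg hh.le]
      gcongr
      exact hvM k hk.le) (Nat.zero_le k) hk
    have h2 : (k : ℝ) * h ≤ S := le_trans (by gcongr) hS
    have h3 := mul_le_mul_of_nonneg_left h2 hM0
    simp only [Nat.cast_zero, sub_zero] at this
    linarith

/-- One fixed ultrafilter gives limits at all times simultaneously, in place of Arzelà-Ascoli and a
diagonal subsequence. -/
theorem exists_tendsto_hyperfilter {E : Type*} [PseudoMetricSpace E] [ProperSpace E]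
    {u : ℕ → E} {c : E} {R : ℝ} (hu : ∀ᶠ k in atTop, dist (u k) c ≤ R) :
    ∃ l, Tendsto u (hyperfilter ℕ) (𝓝 l) := by
  have hle : (hyperfilter ℕ : Filter ℕ) ≤ atTop := by
    rw [← Nat.cofinite_eq_atTop]; exact hyperfilter_le_cofinite
  obtain ⟨l, -, hl⟩ := (isCompact_closedBall c R).ultrafilter_le_nhds ((hyperfilter ℕ).map u)
    (le_principal_iff.2 (hle hu))
  exact ⟨l, hl⟩

theorem IsRegularMultifunction.exists_lipschitz_nonneg {F : ℝ → Euc n → Set (Euc n)}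
    (hF : IsRegularMultifunction F) (T : ℝ) : ∃ L : ℝ, 0 ≤ L ∧
      ∀ s ∈ Set.Icc 0 T, ∀ t ∈ Set.Icc 0 T, ∀ x y : Euc n,
        Metric.hausdorffDist (F s x) (F t y) ≤ L * (|s - t| + ‖x - y‖) := by
  obtain ⟨L, hL⟩ := hF.lipschitz T
  refine ⟨max L 0, le_max_right _ _, fun s hs t ht x y => (hL s hs t ht x y).trans ?_⟩
  gcongr
  exact le_max_left _ _

/-- Ultrafilter limits of Euler polygons: `v` is locally Lipschitz, `x` has right derivative `v`,
and `v` is a selection of `F` along `x`. -/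
theorem IsRegularMultifunction.exists_euler_limit {F : ℝ → Euc n → Set (Euc n)}
    (hF : IsRegularMultifunction F) {t₀ : ℝ} (ht₀ : 0 ≤ t₀) (x₀ : Euc n) :
    ∃ x v : ℝ → Euc n, x t₀ = x₀ ∧
      (∀ T, t₀ ≤ T → ∃ C : ℝ, ∀ s t, t₀ ≤ s → s ≤ t → t ≤ T →
        ‖v t - v s‖ ≤ C * (t - s) ∧ ‖x t - x s - (t - s) • v s‖ ≤ C * (t - s) ^ 2) ∧
      ∀ t, t₀ ≤ t → v t ∈ F t (x t) := by
  obtain ⟨v₀, hv₀⟩ := (hF.isPathConnected t₀ ht₀ x₀).nonempty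
  let h : ℕ → ℝ := fun N => 1 / ((N : ℝ) + 1)
  have hh : ∀ N, 0 < h N := fun N => by positivity
  have hle : (hyperfilter ℕ : Filter ℕ) ≤ atTop := by
    rw [← Nat.cofinite_eq_atTop]; exact hyperfilter_le_cofinite
  have hh0 : Tendsto h (hyperfilter ℕ) (𝓝 0) :=
    (tendsto_one_div_add_atTop_nhds_zero_nat (𝕜 := ℝ)).mono_left hle
  choose X V hX0 hV0 hX hV hVn using fun N => hF.exists_euler ht₀ (hh N) hv₀
  -- For `t ≥ t₀`, the index of the last grid node not after `t`; the approximants are step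
  -- functions, not interpolated polygons.
  let J : ℕ → ℝ → ℕ := fun N t => ⌊(t - t₀) / h N⌋₊
  have hJle : ∀ N t, t₀ ≤ t → J N t * h N ≤ t - t₀ := by
    intro N t ht
    have := Nat.floor_le (div_nonneg (sub_nonneg.2 ht) (hh N).le)
    rwa [le_div_iff₀ (hh N)] at this
  have hJlt : ∀ N t, t - t₀ - h N < J N t * h N := by
    intro N t
    have := Nat.lt_floor_add_one ((t - t₀) / h N)
    rw [div_lt_iff₀ (hh N)] at this
    simp only [J]
    linarith
  have hJmono : ∀ N s t, s ≤ t → J N s ≤ J N t := fun N s t hst =>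
    Nat.floor_mono (div_le_div_of_nonneg_right (by linarith) (hh N).le)
  have hJlim : ∀ t, t₀ ≤ t → Tendsto (fun N => J N t * h N) (hyperfilter ℕ) (𝓝 (t - t₀)) := by
    intro t ht
    refine tendsto_of_tendsto_of_tendsto_of_le_of_le ?_ tendsto_const_nhds
      (fun N => (hJlt N t).le) (fun N => hJle N t ht)
    simpa using (tendsto_const_nhds (x := t - t₀)).sub hh0
  -- The constants precede `N`: they are uniform in the step size, so the estimates survive the
  -- limit.
  have key : ∀ T, t₀ ≤ T → ∃ C M : ℝ, ∀ N,
      (∀ t ≤ T, ‖V N (J N t)‖ ≤ M) ∧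
      (∀ s t, s ≤ t → t ≤ T →
        ‖V N (J N t) - V N (J N s)‖ ≤ C * (J N t * h N - J N s * h N)) ∧
      (∀ s t, s ≤ t → t ≤ T →
        ‖X N (J N t) - X N (J N s) - (J N t * h N - J N s * h N) • V N (J N s)‖
          ≤ C * (J N t * h N - J N s * h N) ^ 2) ∧
      ∀ t ≤ T, ‖X N (J N t) - x₀‖ ≤ M * (T - t₀) := by
    intro T hT
    obtain ⟨L, hL, hLip⟩ := hF.exists_lipschitz_nonneg T
    refine ⟨L * ((1 + ‖v₀‖) * Real.exp (L * (T - t₀))), (1 + ‖v₀‖) * Real.exp (L * (T - t₀)),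
      fun N => ?_⟩
    have hb := euler_bounds (x := X N) (v := V N) (K := J N T) (S := T - t₀) (hh N) hL (hX N) ?_
      (hJle N T hT) rfl
    · rw [hV0 N, hX0 N] at hb
      obtain ⟨b1, b2, b3, b4⟩ := hb
      exact ⟨fun t ht => b1 _ (hJmono N t T ht),
        fun s t hst ht => b2 _ _ (hJmono N s t hst) (hJmono N t T ht),
        fun s t hst ht => b3 _ _ (hJmono N s t hst) (hJmono N t T ht),
        fun t ht => b4 _ (hJmono N t T ht)⟩
    · intro k hk
      have h1 : ∀ j : ℕ, j ≤ J N T → t₀ + j * h N ∈ Set.Icc 0 T := by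
        intro j hj
        have h2 : (j : ℝ) * h N ≤ J N T * h N := by
          have := (hh N).le
          gcongr
        have h3 : 0 ≤ (j : ℝ) * h N := mul_nonneg (Nat.cast_nonneg _) (hh N).le
        exact ⟨by linarith, by linarith [hJle N T hT]⟩
      refine (hVn N k).trans ((hLip _ (h1 k hk.le) _ (h1 (k + 1) hk) _ _).trans_eq ?_)
      congr 2
      have : t₀ + (k : ℝ) * h N - (t₀ + ((k + 1 : ℕ) : ℝ) * h N) = -h N := by push_cast; ring
      rw [this, abs_neg, abs_of_pos (hh N)]
  have hlimV : ∀ t, ∃ l, t₀ ≤ t → Tendsto (fun N => V N (J N t)) (hyperfilter ℕ) (𝓝 l) := by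
    intro t
    by_cases ht : t₀ ≤ t
    · obtain ⟨C, M, hk⟩ := key t ht
      obtain ⟨l, hl⟩ := exists_tendsto_hyperfilter (u := fun N => V N (J N t)) (c := 0) (R := M)
        (Eventually.of_forall fun N => by simpa using (hk N).1 t le_rfl)
      exact ⟨l, fun _ => hl⟩
    · exact ⟨0, fun h' => absurd h' ht⟩
  have hlimX : ∀ t, ∃ l, t₀ ≤ t → Tendsto (fun N => X N (J N t)) (hyperfilter ℕ) (𝓝 l) := by
    intro t
    by_cases ht : t₀ ≤ t
    · obtain ⟨C, M, hk⟩ := key t ht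
      obtain ⟨l, hl⟩ := exists_tendsto_hyperfilter (u := fun N => X N (J N t)) (c := x₀)
        (R := M * (t - t₀))
        (Eventually.of_forall fun N => by simpa [dist_eq_norm] using (hk N).2.2.2 t le_rfl)
      exact ⟨l, fun _ => hl⟩
    · exact ⟨0, fun h' => absurd h' ht⟩
  choose v hv using hlimV
  choose x hx using hlimX
  have hlim : ∀ T, t₀ ≤ T → ∃ C : ℝ, ∀ s t, t₀ ≤ s → s ≤ t → t ≤ T →
      ‖v t - v s‖ ≤ C * (t - s) ∧ ‖x t - x s - (t - s) • v s‖ ≤ C * (t - s) ^ 2 := by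
    intro T hT
    obtain ⟨C, M, hk⟩ := key T hT
    refine ⟨C, fun s t hs hst ht => ?_⟩
    have hts : Tendsto (fun N => J N t * h N - J N s * h N) (hyperfilter ℕ) (𝓝 (t - s)) := by
      simpa using (hJlim t (hs.trans hst)).sub (hJlim s hs)
    exact ⟨le_of_tendsto_of_tendsto' ((hv t (hs.trans hst)).sub (hv s hs)).norm
        (hts.const_mul C) (fun N => (hk N).2.1 s t hst ht),
      le_of_tendsto_of_tendsto' (((hx t (hs.trans hst)).sub (hx s hs)).sub
        (hts.smul (hv s hs))).norm ((hts.pow 2).const_mul C)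
        (fun N => (hk N).2.2.1 s t hst ht)⟩
  -- The approximating velocity lies in the value of `F` at its node, and node time and state
  -- converge to `t` and `x t`. The Lipschitz estimate sends its distance to `F t (x t)` to zero,
  -- and this value is closed.
  have hmem : ∀ t, t₀ ≤ t → v t ∈ F t (x t) := by
    intro t ht
    have ht0 : 0 ≤ t := ht₀.trans ht
    obtain ⟨L, hL, hLip⟩ := hF.exists_lipschitz_nonneg t
    rw [(hF.isCompact t ht0 _).isClosed.mem_iff_infDist_zero (hF.isPathConnected t ht0 _).nonempty]
    refine le_antisymm ?_ Metric.infDist_nonneg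
    have h1 : Tendsto (fun N => Metric.infDist (V N (J N t)) (F t (x t))) (hyperfilter ℕ)
        (𝓝 (Metric.infDist (v t) (F t (x t)))) :=
      ((Metric.continuous_infDist_pt _).tendsto _).comp (hv t ht)
    have h2 : Tendsto (fun N => L * (|t₀ + J N t * h N - t| + ‖X N (J N t) - x t‖))
        (hyperfilter ℕ) (𝓝 0) := by
      have h3 := (((hJlim t ht).const_add t₀).sub_const t).abs
      have h4 := ((hx t ht).sub_const (x t)).norm
      simpa using (h3.add h4).const_mul L
    refine le_of_tendsto_of_tendsto' h1 h2 fun N => ?_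
    have h5 : 0 ≤ (J N t : ℝ) * h N := mul_nonneg (Nat.cast_nonneg _) (hh N).le
    have h6 : t₀ + J N t * h N ∈ Set.Icc 0 t := ⟨by linarith, by linarith [hJle N t ht]⟩
    exact (Metric.infDist_le_hausdorffDist_of_mem (hV N (J N t))
      (hF.hausdorffEDist_ne_top h6.1 ht0 _ _)).trans (hLip _ h6 t ⟨ht0, le_rfl⟩ _ _)
  refine ⟨x, v, tendsto_nhds_unique (hx t₀ le_rfl) ?_, hlim, hmem⟩
  have : ∀ N, X N (J N t₀) = x₀ := fun N => by simp [J, hX0 N]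
  simp only [this]
  exact tendsto_const_nhds

/-- A regular multifunction has a continuously differentiable trajectory from each state. -/
theorem IsRegularMultifunction.exists_trajectory {F : ℝ → Euc n → Set (Euc n)}
    (hF : IsRegularMultifunction F) {t₀ : ℝ} (ht₀ : 0 ≤ t₀) (x₀ : Euc n) :
    ∃ x : ℝ → Euc n, IsTrajectory F t₀ x ∧ x t₀ = x₀ := by
  obtain ⟨x, v, hx0, hlim, hmem⟩ := hF.exists_euler_limit ht₀ x₀
  have hvcont : ∀ T, t₀ ≤ T → ContinuousOn v (Set.Icc t₀ T) := by
    intro T hT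
    obtain ⟨C, hC⟩ := hlim T hT
    refine (LipschitzOnWith.of_dist_le_mul (K := C.toNNReal) ?_).continuousOn
    have aux : ∀ s t, t₀ ≤ s → s ≤ t → t ≤ T → dist (v t) (v s) ≤ C.toNNReal * dist t s := by
      intro s t hs hst ht
      rw [dist_eq_norm, Real.dist_eq, abs_of_nonneg (sub_nonneg.2 hst)]
      exact (hC s t hs hst ht).1.trans
        (mul_le_mul_of_nonneg_right (Real.le_coe_toNNReal C) (sub_nonneg.2 hst))
    intro s hs t ht
    rcases le_total s t with hst | hst
    · rw [dist_comm, dist_comm s t]; exact aux s t hs.1 hst ht.2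
    · exact aux t s ht.1 hst hs.2
  -- The quadratic estimate uses the velocity at the left endpoint, hence a right derivative; with
  -- continuity of `x` this suffices for the fundamental theorem of calculus.
  have hder : ∀ s, t₀ ≤ s → HasDerivWithinAt x (v s) (Set.Ioi s) s := by
    intro s hs
    obtain ⟨C, hC⟩ := hlim (s + 1) (by linarith)
    rw [hasDerivWithinAt_iff_isLittleO]
    have hO : (fun t => x t - x s - (t - s) • v s) =O[𝓝[>] s] fun t => (t - s) ^ 2 := by
      refine Asymptotics.IsBigO.of_bound C ?_
      filter_upwards [Ioo_mem_nhdsGT (show s < s + 1 by linarith)] with t ht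
      rw [Real.norm_of_nonneg (sq_nonneg _)]
      exact (hC s t hs ht.1.le ht.2.le).2
    refine hO.trans_isLittleO ?_
    have : (fun t : ℝ => ‖t - s‖ ^ 2) =o[𝓝 s] fun t => (t - s) :=
      Asymptotics.isLittleO_pow_sub_sub s one_lt_two
    simp only [Real.norm_eq_abs, sq_abs] at this
    exact this.mono nhdsWithin_le_nhds
  have hxcont : ∀ T, t₀ ≤ T → ContinuousOn x (Set.Icc t₀ T) := by
    intro T hT
    obtain ⟨C, hC⟩ := hlim T hT
    obtain ⟨B, hB⟩ := (isCompact_Icc (a := t₀) (b := T)).exists_bound_of_continuousOn (hvcont T hT)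
    -- A Lipschitz constant of `x`: the quadratic remainder contributes `|C| * (T - t₀)` and the
    -- velocity contributes its bound `B`.
    let D : ℝ := |C| * (T - t₀) + B
    have aux : ∀ s t, t₀ ≤ s → s ≤ t → t ≤ T → dist (x t) (x s) ≤ D.toNNReal * dist t s := by
      intro s t hs hst ht
      have hts : 0 ≤ t - s := sub_nonneg.2 hst
      rw [dist_eq_norm, Real.dist_eq, abs_of_nonneg hts]
      have h1 := (hC s t hs hst ht).2
      have h2 := hB s ⟨hs, hst.trans ht⟩
      have h3 : ‖x t - x s‖ ≤ ‖x t - x s - (t - s) • v s‖ + (t - s) * ‖v s‖ := by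
        have := norm_add_le (x t - x s - (t - s) • v s) ((t - s) • v s)
        rwa [sub_add_cancel, norm_smul, Real.norm_of_nonneg hts] at this
      have h4 : C * (t - s) ^ 2 ≤ |C| * (T - t₀) * (t - s) := by
        have : C * (t - s) ≤ |C| * (T - t₀) :=
          mul_le_mul (le_abs_self C) (by linarith) hts (abs_nonneg C)
        nlinarith
      calc ‖x t - x s‖ ≤ D * (t - s) := by
            simp only [D]
            nlinarith [mul_le_mul_of_nonneg_left h2 hts]
        _ ≤ _ := mul_le_mul_of_nonneg_right (Real.le_coe_toNNReal D) hts
    refine (LipschitzOnWith.of_dist_le_mul (K := D.toNNReal) ?_).continuousOn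
    intro s hs t ht
    rcases le_total s t with hst | hst
    · rw [dist_comm, dist_comm s t]; exact aux s t hs.1 hst ht.2
    · exact aux t s ht.1 hst hs.2
  have hint : ∀ t, t₀ ≤ t → IntervalIntegrable v volume t₀ t := fun t ht =>
    ContinuousOn.intervalIntegrable (by rw [Set.uIcc_of_le ht]; exact hvcont t ht)
  refine ⟨x, ⟨v, hint, fun t ht => ?_, ?_⟩, hx0⟩
  · rw [intervalIntegral.integral_eq_sub_of_hasDeriv_right
      (by rw [Set.uIcc_of_le ht]; exact hxcont t ht)
      (fun s hs => hder s (by rw [min_eq_left ht] at hs; exact hs.1.le)) (hint t ht)]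
    abel
  · exact (ae_restrict_mem measurableSet_Ici).mono fun s hs => hmem s hs

end Existence

end Reach

namespace Reach

/-! ### The Bihari-LaSalle inequality -/

section Bihari

variable {ω a φ : ℝ → ℝ} {r₀ : ℝ}

theorem hasDerivAt_bihariG (hω : ContinuousOn ω (Ici 0)) (hpos : ∀ s, 0 < s → 0 < ω s)
    (hr₀ : 0 < r₀) {r : ℝ} (hr : 0 < r) : HasDerivAt (bihariG ω r₀) (1 / ω r) r := by
  have hc : ContinuousOn (fun s => 1 / ω s) (Ioi 0) :=
    continuousOn_const.div (hω.mono Ioi_subset_Ici_self) fun s hs => (hpos s hs).ne'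
  refine intervalIntegral.integral_hasDerivAt_right ?_
    (hc.stronglyMeasurableAtFilter isOpen_Ioi _ hr) (hc.continuousAt (Ioi_mem_nhds hr))
  refine (hc.mono fun s hs => ?_).intervalIntegrable
  exact (lt_min hr₀ hr).trans_le hs.1

theorem strictMonoOn_bihariG (hω : ContinuousOn ω (Ici 0)) (hpos : ∀ s, 0 < s → 0 < ω s)
    (hr₀ : 0 < r₀) : StrictMonoOn (bihariG ω r₀) (Ioi 0) := by
  refine strictMonoOn_of_deriv_pos (convex_Ioi 0)
    (fun r hr => (hasDerivAt_bihariG hω hpos hr₀ hr).continuousAt.continuousWithinAt) ?_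
  intro r hr
  rw [interior_Ioi] at hr
  rw [(hasDerivAt_bihariG hω hpos hr₀ hr).deriv]
  exact one_div_pos.2 (hpos r hr)

/-- The Bihari-LaSalle inequality. -/
theorem bihariG_le_of_le_integral (hω : ContinuousOn ω (Ici 0)) (hpos : ∀ s, 0 < s → 0 < ω s)
    (hmono : MonotoneOn ω (Ici 0)) (hr₀ : 0 < r₀) {t₀ T β : ℝ} (hT : t₀ ≤ T)
    (ha : ContinuousOn a (Icc t₀ T)) (ha0 : ∀ t ∈ Icc t₀ T, 0 ≤ a t)
    (hφ : ContinuousOn φ (Icc t₀ T)) (hφ0 : ∀ t ∈ Icc t₀ T, 0 ≤ φ t) (hβ : 0 < β)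
    (hle : ∀ t ∈ Icc t₀ T, φ t ≤ β + ∫ s in t₀..t, a s * ω (φ s)) :
    ∃ z, φ T ≤ z ∧ 0 < z ∧ bihariG ω r₀ z ≤ bihariG ω r₀ β + ∫ s in t₀..T, a s := by
  have hωφ : ContinuousOn (fun s => a s * ω (φ s)) (Icc t₀ T) :=
    ha.mul (hω.comp hφ fun t ht => hφ0 t ht)
  have hω0 : ∀ s, 0 ≤ s → 0 ≤ ω s := fun s hs => by
    rcases hs.eq_or_lt with h | h
    · subst h
      refine ge_of_tendsto ((hω 0 self_mem_Ici).mono Ioi_subset_Ici_self) ?_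
      filter_upwards [self_mem_nhdsWithin] with r hr using (hpos r hr).le
    · exact (hpos s h).le
  have hnn : ∀ s ∈ Icc t₀ T, 0 ≤ a s * ω (φ s) := fun s hs =>
    mul_nonneg (ha0 s hs) (hω0 _ (hφ0 s hs))
  have hprim : ∀ q : ℝ → ℝ, ContinuousOn q (Icc t₀ T) →
      ContinuousOn (fun t => ∫ s in t₀..t, q s) (Icc t₀ T) ∧
      ∀ t ∈ Ioo t₀ T, HasDerivAt (fun t => ∫ s in t₀..t, q s) (q t) t := by
    intro q hq
    constructor
    · have := intervalIntegral.continuousOn_primitive_interval (μ := volume) (f := q)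
        (a := t₀) (b := T) (by rw [uIcc_of_le hT]; exact hq.integrableOn_Icc)
      rwa [uIcc_of_le hT] at this
    · intro t ht
      refine intervalIntegral.integral_hasDerivAt_right ?_
        ((hq.mono Ioo_subset_Icc_self).stronglyMeasurableAtFilter isOpen_Ioo _ ht)
        (hq.continuousAt (Icc_mem_nhds ht.1 ht.2))
      refine (hq.mono ?_).intervalIntegrable
      rw [uIcc_of_le ht.1.le]
      exact Icc_subset_Icc_right ht.2.le
  -- `φ` may vanish and so leave the domain of `G`, while `z ≥ β > 0`; the conclusion is therefore
  -- phrased through the majorant `z T`.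
  set z : ℝ → ℝ := fun t => β + ∫ s in t₀..t, a s * ω (φ s) with hz
  have hzβ : ∀ t ∈ Icc t₀ T, β ≤ z t := fun t ht => by
    have : 0 ≤ ∫ s in t₀..t, a s * ω (φ s) :=
      intervalIntegral.integral_nonneg ht.1 fun s hs => hnn s ⟨hs.1, hs.2.trans ht.2⟩
    simp only [hz]; linarith
  have hz0 : ∀ t ∈ Icc t₀ T, 0 < z t := fun t ht => hβ.trans_le (hzβ t ht)
  -- The derivative is `a * (1 - ω(φ) / ω(z))`, nonnegative because `φ ≤ z` and `ω` is
  -- nondecreasing.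
  have hmonoD : MonotoneOn (fun t => (∫ s in t₀..t, a s) - bihariG ω r₀ (z t)) (Icc t₀ T) := by
    refine monotoneOn_of_hasDerivWithinAt_nonneg
      (f' := fun t => a t - 1 / ω (z t) * (a t * ω (φ t))) (convex_Icc _ _) ?_ ?_ ?_
    · refine (hprim a ha).1.sub ?_
      intro t ht
      exact (hasDerivAt_bihariG hω hpos hr₀ (hz0 t ht)).continuousAt.comp_continuousWithinAt
        (((hprim _ hωφ).1.const_add β) t ht)
    · intro t ht
      rw [interior_Icc] at ht
      have h1 := (hprim a ha).2 t ht
      have h2 : HasDerivAt z (a t * ω (φ t)) t := ((hprim _ hωφ).2 t ht).const_add β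
      have h3 := (hasDerivAt_bihariG hω hpos hr₀ (hz0 t (Ioo_subset_Icc_self ht))).comp t h2
      exact (h1.sub h3).hasDerivWithinAt
    · intro t ht
      rw [interior_Icc] at ht
      have ht' := Ioo_subset_Icc_self ht
      have h1 := hpos _ (hz0 t ht')
      have h2 := hmono (hφ0 t ht') (hz0 t ht').le (hle t ht')
      have h3 : 1 / ω (z t) * (a t * ω (φ t)) = a t * (ω (φ t) / ω (z t)) := by ring
      have h4 : ω (φ t) / ω (z t) ≤ 1 := (div_le_one h1).2 h2
      have h5 := mul_le_mul_of_nonneg_left h4 (ha0 t ht')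
      linarith
  have hfin := hmonoD ⟨le_rfl, hT⟩ ⟨hT, le_rfl⟩ hT
  have hzt₀ : z t₀ = β := by simp [hz]
  simp only [intervalIntegral.integral_same, hzt₀] at hfin
  exact ⟨z T, hle T ⟨hT, le_rfl⟩, hz0 T ⟨hT, le_rfl⟩, by linarith⟩

end Bihari

/-! ### Well-definedness and monotonicity of the bound -/

section Eta

variable {n : ℕ} {t₀ tf c κ : ℝ} {a b : Fin n → ℝ → ℝ} {w : Fin n → ℝ → ℝ → ℝ} {r₀ : Fin n → ℝ}

theorem IsGrowthData.continuousOn_slice (hdata : IsGrowthData t₀ tf a b w) (hc : 0 ≤ c)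
    (i : Fin n) : ContinuousOn (fun s => w i s c) (Ici 0) :=
  (hdata.continuousOn_w i).comp (f := fun s : ℝ => (s, c)) (by fun_prop) fun _ hs => ⟨hs, hc⟩

theorem IsGrowthData.integral_mono_a (hdata : IsGrowthData t₀ tf a b w) (i : Fin n) {t : ℝ}
    (ht : t ∈ Icc t₀ tf) :
    0 ≤ ∫ s in t₀..t, a i s ∧ ∫ s in t₀..t, a i s ≤ ∫ s in t₀..tf, a i s := by
  have hI : ∀ p ∈ Icc t₀ tf, ∀ q ∈ Icc t₀ tf, IntervalIntegrable (a i) volume p q :=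
    fun p hp q hq => ((hdata.continuousOn_a i).mono
      (ordConnected_Icc.uIcc_subset hp hq)).intervalIntegrable
  have h0 : t₀ ∈ Icc t₀ tf := ⟨le_rfl, ht.1.trans ht.2⟩
  have h1 : tf ∈ Icc t₀ tf := ⟨ht.1.trans ht.2, le_rfl⟩
  refine ⟨intervalIntegral.integral_nonneg ht.1 fun s hs =>
    (hdata.pos_a i s ⟨hs.1, hs.2.trans ht.2⟩).le, ?_⟩
  rw [← intervalIntegral.integral_add_adjacent_intervals (hI _ h0 _ ht) (hI _ ht _ h1)]
  exact le_add_of_nonneg_right (intervalIntegral.integral_nonneg ht.2 fun s hs =>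
    (hdata.pos_a i s ⟨ht.1.trans hs.1, hs.2⟩).le)

theorem IsGrowthData.integral_mono_b (hdata : IsGrowthData t₀ tf a b w) (i : Fin n) {t : ℝ}
    (ht : t ∈ Icc t₀ tf) : ∫ s in t₀..t, b i s ≤ ∫ s in t₀..tf, b i s := by
  have hI : ∀ p ∈ Icc t₀ tf, ∀ q ∈ Icc t₀ tf, IntervalIntegrable (b i) volume p q :=
    fun p hp q hq => ((hdata.continuousOn_b i).mono
      (ordConnected_Icc.uIcc_subset hp hq)).intervalIntegrable
  have h0 : t₀ ∈ Icc t₀ tf := ⟨le_rfl, ht.1.trans ht.2⟩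
  have h1 : tf ∈ Icc t₀ tf := ⟨ht.1.trans ht.2, le_rfl⟩
  rw [← intervalIntegral.integral_add_adjacent_intervals (hI _ h0 _ ht) (hI _ ht _ h1)]
  exact le_add_of_nonneg_right (intervalIntegral.integral_nonneg ht.2 fun s hs =>
    (hdata.pos_b i s ⟨ht.1.trans hs.1, hs.2⟩).le)

theorem IsGrowthData.integral_b_pos (hdata : IsGrowthData t₀ tf a b w) (i : Fin n) {t : ℝ}
    (ht : t ∈ Ioc t₀ tf) : 0 < ∫ s in t₀..t, b i s := by
  refine intervalIntegral.intervalIntegral_pos_of_pos_on ?_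
    (fun s hs => hdata.pos_b i s ⟨hs.1.le, hs.2.le.trans ht.2⟩) ht.1
  refine ((hdata.continuousOn_b i).mono ?_).intervalIntegrable
  rw [uIcc_of_le ht.1.le]
  exact Icc_subset_Icc_right ht.2

variable (hdata : IsGrowthData t₀ tf a b w) (hc : 0 ≤ c) (hκ : 0 ≤ κ) (hr₀ : ∀ i, 0 < r₀ i)
  (hdom : ∀ i, bihariArg (fun s => w i s c) (a i) (b i) (r₀ i) t₀ tf κ ∈
    bihariG (fun s => w i s c) (r₀ i) '' Ioi 0)

include hdata hc hκ hr₀ hdom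

/-- The domain condition at `tf` suffices for earlier times: the argument at `t` lies between `G(κ +
∫ b)` and the argument at `tf`, both in the range of `G`, which is an interval. -/
theorem eta_spec (i : Fin n) {t : ℝ} (ht : t ∈ Ioc t₀ tf) :
    0 < eta a b w r₀ t₀ t c κ i ∧ bihariG (fun s => w i s c) (r₀ i) (eta a b w r₀ t₀ t c κ i) =
      bihariArg (fun s => w i s c) (a i) (b i) (r₀ i) t₀ t κ ∧
    bihariArg (fun s => w i s c) (a i) (b i) (r₀ i) t₀ t κ ≤
      bihariArg (fun s => w i s c) (a i) (b i) (r₀ i) t₀ tf κ := by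
  have hω := hdata.continuousOn_slice hc i
  have hpos : ∀ s, 0 < s → 0 < w i s c := fun s hs => hdata.pos_w i s c hs hc
  have hsm := strictMonoOn_bihariG hω hpos (hr₀ i)
  have ht' := Ioc_subset_Icc_self ht
  have htf : tf ∈ Ioc t₀ tf := ⟨ht.1.trans_le ht.2, le_rfl⟩
  have hβ : 0 < κ + ∫ s in t₀..t, b i s := by linarith [hdata.integral_b_pos i ht]
  have hβf : 0 < κ + ∫ s in t₀..tf, b i s := by linarith [hdata.integral_b_pos i htf]
  have hle : bihariArg (fun s => w i s c) (a i) (b i) (r₀ i) t₀ t κ ≤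
      bihariArg (fun s => w i s c) (a i) (b i) (r₀ i) t₀ tf κ :=
    add_le_add (hsm.monotoneOn hβ hβf (by linarith [hdata.integral_mono_b i ht']))
      (hdata.integral_mono_a i ht').2
  have hmem : bihariArg (fun s => w i s c) (a i) (b i) (r₀ i) t₀ t κ ∈
      bihariG (fun s => w i s c) (r₀ i) '' Ioi 0 := by
    have hconn : IsPreconnected (bihariG (fun s => w i s c) (r₀ i) '' Ioi 0) :=
      isPreconnected_Ioi.image _ fun r hr =>
        (hasDerivAt_bihariG hω hpos (hr₀ i) hr).continuousAt.continuousWithinAt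
    refine hconn.ordConnected.out ⟨_, hβ, rfl⟩ (hdom i) ⟨?_, hle⟩
    exact le_add_of_nonneg_right (hdata.integral_mono_a i ht').1
  have heta : eta a b w r₀ t₀ t c κ i = bihariGInv (fun s => w i s c) (r₀ i)
      (bihariArg (fun s => w i s c) (a i) (b i) (r₀ i) t₀ t κ) := if_neg ht.1.ne'
  rw [heta]
  exact ⟨Function.invFunOn_mem hmem, Function.invFunOn_eq hmem, hle⟩

theorem eta_le_eta_final (htf : t₀ < tf) (i : Fin n) {t : ℝ} (ht : t ∈ Icc t₀ tf) :
    eta a b w r₀ t₀ t c κ i ≤ eta a b w r₀ t₀ tf c κ i := by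
  have hsm := strictMonoOn_bihariG (hdata.continuousOn_slice hc i)
    (fun s hs => hdata.pos_w i s c hs hc) (hr₀ i)
  have htf' : tf ∈ Ioc t₀ tf := ⟨htf, le_rfl⟩
  obtain ⟨f1, f2, -⟩ := eta_spec hdata hc hκ hr₀ hdom i htf'
  rcases ht.1.eq_or_lt with rfl | h
  -- Here `κ` may be `0`, where `G` cannot be used; the comparison goes through the positive number
  -- `κ + ∫ b` up to `tf`.
  · have h1 : eta a b w r₀ t₀ t₀ c κ i = κ := if_pos rfl
    have hb := hdata.integral_b_pos i htf'
    have hβf : 0 < κ + ∫ s in t₀..tf, b i s := by linarith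
    have h2 : κ + ∫ s in t₀..tf, b i s ≤ eta a b w r₀ t₀ tf c κ i := by
      rw [← hsm.le_iff_le hβf f1, f2]
      exact le_add_of_nonneg_right (hdata.integral_mono_a i ⟨htf.le, le_rfl⟩).1
    rw [h1]; linarith
  · obtain ⟨e1, e2, e3⟩ := eta_spec hdata hc hκ hr₀ hdom i ⟨h, ht.2⟩
    rw [← hsm.le_iff_le e1 f1, e2, f2]
    exact e3

/-- A continuous `φ ≥ 0` whose growth is controlled by `a`, `b`, `w` stays below `eta`. -/
theorem le_eta_of_le_integral (i : Fin n) {φ : ℝ → ℝ} (hφ : ContinuousOn φ (Icc t₀ tf))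
    (hφ0 : ∀ t ∈ Icc t₀ tf, 0 ≤ φ t)
    (hle : ∀ t ∈ Icc t₀ tf, φ t ≤ κ + ∫ s in t₀..t, (a i s * w i (φ s) c + b i s))
    {t : ℝ} (ht : t ∈ Icc t₀ tf) : φ t ≤ eta a b w r₀ t₀ t c κ i := by
  rcases ht.1.eq_or_lt with rfl | h
  · simpa [eta] using hle t₀ ht
  have hω := hdata.continuousOn_slice hc i
  have hpos : ∀ s, 0 < s → 0 < w i s c := fun s hs => hdata.pos_w i s c hs hc
  have hsub : Icc t₀ t ⊆ Icc t₀ tf := Icc_subset_Icc_right ht.2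
  have hb := hdata.integral_b_pos i ⟨h, ht.2⟩
  have hca : ContinuousOn (fun s => a i s * w i (φ s) c) (Icc t₀ tf) :=
    (hdata.continuousOn_a i).mul (hω.comp hφ fun s hs => hφ0 s hs)
  have hβ : 0 < κ + ∫ s in t₀..t, b i s := by linarith
  -- With `t` fixed, the integral of `b` is enlarged to all of `[t₀, t]`, which turns it into part
  -- of the constant `β`.
  have hle' : ∀ s ∈ Icc t₀ t, φ s ≤ (κ + ∫ p in t₀..t, b i p) +
      ∫ p in t₀..s, a i p * w i (φ p) c := by
    intro s hs
    have hI : ∀ q : ℝ → ℝ, ContinuousOn q (Icc t₀ tf) → ∀ p ∈ Icc t₀ tf, ∀ p' ∈ Icc t₀ tf,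
        IntervalIntegrable q volume p p' := fun q hq p hp p' hp' =>
      (hq.mono (ordConnected_Icc.uIcc_subset hp hp')).intervalIntegrable
    have h0 : t₀ ∈ Icc t₀ tf := ⟨le_rfl, ht.1.trans ht.2⟩
    have h1 := hle s (hsub hs)
    rw [intervalIntegral.integral_add (hI _ hca _ h0 _ (hsub hs))
      (hI _ (hdata.continuousOn_b i) _ h0 _ (hsub hs))] at h1
    have h2 : ∫ p in t₀..s, b i p ≤ ∫ p in t₀..t, b i p := by
      rw [← intervalIntegral.integral_add_adjacent_intervals
        (hI _ (hdata.continuousOn_b i) _ h0 _ (hsub hs))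
        (hI _ (hdata.continuousOn_b i) _ (hsub hs) _ ht)]
      exact le_add_of_nonneg_right (intervalIntegral.integral_nonneg hs.2 fun p hp =>
        (hdata.pos_b i p ⟨hs.1.trans hp.1, hp.2.trans ht.2⟩).le)
    linarith
  obtain ⟨z, hz1, hz2, hz3⟩ := bihariG_le_of_le_integral (ω := fun s => w i s c) (a := a i)
    (φ := φ) (r₀ := r₀ i) (β := κ + ∫ s in t₀..t, b i s) hω hpos
    (fun s hs s' _ hss => hdata.mono_w i s s' c c hs hss hc le_rfl) (hr₀ i) ht.1
    ((hdata.continuousOn_a i).mono hsub) (fun s hs => (hdata.pos_a i s (hsub hs)).le)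
    (hφ.mono hsub) (fun s hs => hφ0 s (hsub hs)) hβ hle'
  obtain ⟨e1, e2, -⟩ := eta_spec hdata hc hκ hr₀ hdom i ⟨h, ht.2⟩
  refine hz1.trans ?_
  rw [← (strictMonoOn_bihariG hω hpos (hr₀ i)).le_iff_le hz2 e1, e2]
  exact hz3

end Eta

/-! ### Deviation of two trajectories -/

section Comparison

variable {n : ℕ}

theorem continuousOn_of_eq_add_integral {x v : ℝ → Euc n} {t₀ T : ℝ} (hT : t₀ ≤ T)
    (hv : IntervalIntegrable v volume t₀ T)
    (hx : ∀ t, t₀ ≤ t → x t = x t₀ + ∫ s in t₀..t, v s) : ContinuousOn x (Icc t₀ T) := by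
  have h1 := intervalIntegral.continuousOn_primitive_interval (μ := volume) (f := v)
    (a := t₀) (b := T) (by
      rw [uIcc_of_le hT]
      exact (intervalIntegrable_iff_integrableOn_Icc_of_le hT).1 hv)
  rw [uIcc_of_le hT] at h1
  exact (h1.const_add (x t₀)).congr fun t ht => hx t ht.1

theorem intervalIntegral_apply {v : ℝ → Euc n} {s t : ℝ} (hv : IntervalIntegrable v volume s t)
    (i : Fin n) : (∫ τ in s..t, v τ) i = ∫ τ in s..t, v τ i :=
  ((EuclideanSpace.proj i : Euc n →L[ℝ] ℝ).intervalIntegral_comp_comm hv).symm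

/-- Triangle inequality through a near-closest `u' ∈ U` to `v`, with `‖u - u'‖ ≤ 2δ`. The distance
need not be attained, hence the slack `e`. -/
theorem norm_sub_le_of_infDist_le {E : Type*} [SeminormedAddCommGroup E] {U : Set E} {δ ε : ℝ}
    (hδ : ∀ u ∈ U, ‖u‖ ≤ δ) {u v : E} (hu : u ∈ U) (hv : Metric.infDist v U ≤ ε) :
    ‖u - v‖ ≤ 2 * δ + ε := by
  refine le_of_forall_pos_lt_add fun e he => ?_
  obtain ⟨u', hu', h⟩ := (Metric.infDist_lt_iff ⟨u, hu⟩).1 (hv.trans_lt (lt_add_of_pos_right ε he))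
  have h1 := norm_sub_le u u'
  have h2 := norm_sub_le_norm_sub_add_norm_sub u u' v
  rw [dist_comm, dist_eq_norm] at h
  linarith [hδ u hu, hδ u' hu']

theorem exists_norm_sub_le_of_hausdorffEDist_le {E : Type*} [NormedAddCommGroup E] [ProperSpace E]
    {A B : Set E} {κ : ℝ} (hκ : 0 ≤ κ) (hB : IsClosed B) (hne : B.Nonempty)
    (h : Metric.hausdorffEDist A B ≤ ENNReal.ofReal κ) {p : E} (hp : p ∈ A) :
    ∃ q ∈ B, ‖p - q‖ ≤ κ := by
  obtain ⟨q, hq, hd⟩ := hB.exists_infDist_eq_dist hne p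
  refine ⟨q, hq, ?_⟩
  rw [← dist_eq_norm, ← hd]
  exact ENNReal.toReal_le_of_le_ofReal hκ
    ((Metric.infEDist_le_hausdorffEDist_of_mem hp).trans h)

/-- Any two trajectories with close initial states deviate by at most `eta`. -/
theorem abs_sub_le_eta {m : ℕ} {f g : ℝ → Euc n → Euc m → Euc n} {U V : Set (Euc m)}
    {X₀ Y₀ : Set (Euc n)} {t₀ tf c κ : ℝ} {a b : Fin n → ℝ → ℝ} {w : Fin n → ℝ → ℝ → ℝ}
    {r₀ : Fin n → ℝ} (hc : 0 ≤ c) (hUV : ∀ u ∈ U, ∀ v ∈ V, ‖u - v‖ ≤ c) (hκ : 0 ≤ κ)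
    (hdata : IsGrowthData t₀ tf a b w)
    (hgrowth : HasBoundedDeviationGrowth f g U V X₀ Y₀ t₀ tf κ a b w) (hr₀ : ∀ i, 0 < r₀ i)
    (hdom : ∀ i, bihariArg (fun s => w i s c) (a i) (b i) (r₀ i) t₀ tf κ ∈
      bihariG (fun s => w i s c) (r₀ i) '' Ioi 0)
    {x y : ℝ → Euc n} (hx : IsTrajectory (velocitySet f U) t₀ x) (hx₀ : x t₀ ∈ X₀)
    (hy : IsTrajectory (velocitySet g V) t₀ y) (hy₀ : y t₀ ∈ Y₀) (hxy : ‖x t₀ - y t₀‖ ≤ κ)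
    {t : ℝ} (ht : t ∈ Icc t₀ tf) (i : Fin n) :
    |x t i - y t i| ≤ eta a b w r₀ t₀ t c κ i := by
  have hdev := hgrowth x y hx hx₀ hy hy₀ hxy
  obtain ⟨p, hp1, hp2, hp3⟩ := hx
  obtain ⟨q, hq1, hq2, hq3⟩ := hy
  have htf : t₀ ≤ tf := ht.1.trans ht.2
  have hφ : ContinuousOn (fun s => |x s i - y s i|) (Icc t₀ tf) := by
    have h1 := continuousOn_of_eq_add_integral htf (hp1 tf htf) hp2
    have h2 := continuousOn_of_eq_add_integral htf (hq1 tf htf) hq2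
    have h3 : ∀ z : ℝ → Euc n, ContinuousOn z (Icc t₀ tf) →
        ContinuousOn (fun s => z s i) (Icc t₀ tf) := fun z hz =>
      (EuclideanSpace.proj i : Euc n →L[ℝ] ℝ).continuous.comp_continuousOn hz
    exact ((h3 x h1).sub (h3 y h2)).abs
  refine le_eta_of_le_integral hdata hc hκ hr₀ hdom i hφ (fun _ _ => abs_nonneg _) ?_ ht
  intro s hs
  have hpi : ∀ z : ℝ → Euc n, IntervalIntegrable z volume t₀ s →
      IntervalIntegrable (fun τ => z τ i) volume t₀ s := fun z hz =>
    ⟨(EuclideanSpace.proj i : Euc n →L[ℝ] ℝ).integrable_comp hz.1,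
      (EuclideanSpace.proj i : Euc n →L[ℝ] ℝ).integrable_comp hz.2⟩
  have hI := (hpi p (hp1 s hs.1)).sub (hpi q (hq1 s hs.1))
  have heq : x s i - y s i = (x t₀ i - y t₀ i) + ∫ τ in t₀..s, (p τ i - q τ i) := by
    rw [intervalIntegral.integral_sub (hpi p (hp1 s hs.1)) (hpi q (hq1 s hs.1)),
      ← intervalIntegral_apply (hp1 s hs.1), ← intervalIntegral_apply (hq1 s hs.1),
      hp2 s hs.1, hq2 s hs.1, PiLp.add_apply, PiLp.add_apply]
    ring
  have hinit : |x t₀ i - y t₀ i| ≤ κ := by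
    have := PiLp.norm_apply_le (x t₀ - y t₀) i
    rw [PiLp.sub_apply, Real.norm_eq_abs] at this
    exact this.trans hxy
  have hbound : ∀ᵐ τ ∂(volume.restrict (Icc t₀ s)), |p τ i - q τ i| ≤
      a i τ * w i |x τ i - y τ i| c + b i τ := by
    have hr : ∀ᵐ τ ∂(volume.restrict (Icc t₀ s)), p τ ∈ velocitySet f U τ (x τ) :=
      ae_mono (Measure.restrict_mono Icc_subset_Ici_self le_rfl) hp3
    have hr' : ∀ᵐ τ ∂(volume.restrict (Icc t₀ s)), q τ ∈ velocitySet g V τ (y τ) :=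
      ae_mono (Measure.restrict_mono Icc_subset_Ici_self le_rfl) hq3
    filter_upwards [hr, hr', ae_restrict_mem measurableSet_Icc] with τ h1 h2 hτ
    -- Any controls producing the two velocities at this instant will do, so they need not be
    -- matched or measurable in time.
    obtain ⟨u, hu, hu'⟩ := h1
    obtain ⟨v, hv, hv'⟩ := h2
    have hτ' : τ ∈ Icc t₀ tf := ⟨hτ.1, hτ.2.trans hs.2⟩
    have h3 := hdev τ hτ' u hu v hv i
    rw [hu', hv'] at h3
    refine h3.trans ?_
    have h4 := hdata.mono_w i |x τ i - y τ i| _ _ _ (abs_nonneg _) le_rfl (norm_nonneg _)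
      (hUV u hu v hv)
    have h5 := (hdata.pos_a i τ hτ').le
    gcongr
  have hcont : ContinuousOn (fun τ => a i τ * w i |x τ i - y τ i| c + b i τ) (Icc t₀ s) :=
    (((hdata.continuousOn_a i).mul ((hdata.continuousOn_slice hc i).comp hφ
      fun τ _ => abs_nonneg (x τ i - y τ i))).add (hdata.continuousOn_b i)).mono (Icc_subset_Icc_right hs.2)
  have hint : |∫ τ in t₀..s, (p τ i - q τ i)| ≤
      ∫ τ in t₀..s, (a i τ * w i |x τ i - y τ i| c + b i τ) :=
    (intervalIntegral.abs_integral_le_integral_abs hs.1).trans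
      (intervalIntegral.integral_mono_ae_restrict hs.1 hI.abs
        (ContinuousOn.intervalIntegrable (by rwa [uIcc_of_le hs.1])) hbound)
  change |x s i - y s i| ≤ _
  rw [heq]
  exact (abs_add_le _ _).trans (add_le_add hinit hint)

theorem axisDist_le_of_mem {i : Fin n} {x y : Euc n} {B : Set (Euc n)} (hy : y ∈ B) {r : ℝ}
    (h : |x i - y i| ≤ r) : axisDist i x B ≤ ENNReal.ofReal r :=
  (iInf₂_le y hy).trans (ENNReal.ofReal_le_ofReal h)

end Comparison

end Reach

/-! ### Assembly of the three assertions -/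

theorem mainTheorem3 {n m : ℕ}
    (f g : ℝ → Reach.Euc n → Reach.Euc m → Reach.Euc n)
    (U V : Set (Reach.Euc m)) (X₀ Y₀ : Set (Reach.Euc n))
    (t₀ tf δ ε κ : ℝ)
    (a b : Fin n → ℝ → ℝ) (w : Fin n → ℝ → ℝ → ℝ) (r₀ : Fin n → ℝ)
    (ht₀ : 0 ≤ t₀) (htf : t₀ < tf)
    -- the nominal and the off-nominal multifunctions
    (hF : Reach.IsRegularMultifunction (Reach.velocitySet f U))
    (hG : Reach.IsRegularMultifunction (Reach.velocitySet g V))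
    -- `δ = max ‖u‖` over `U`, and every point of `V` is within distance `ε` of `U`
    (hδ : IsGreatest (norm '' U) δ)
    (hUV : ∀ v ∈ V, Metric.infDist v U ≤ ε)
    -- initial sets
    (hX₀ : IsCompact X₀) (hX₀' : IsPathConnected X₀)
    (hY₀ : IsClosed Y₀) (hY₀' : IsConnected Y₀)
    (hκ : 0 ≤ κ) (hXY : Metric.hausdorffEDist X₀ Y₀ ≤ ENNReal.ofReal κ)
    -- growth of the deviation dynamics, and existence of the bound up to time `tf`
    (hdata : Reach.IsGrowthData t₀ tf a b w)
    (hgrowth : Reach.HasBoundedDeviationGrowth f g U V X₀ Y₀ t₀ tf κ a b w)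
    (hr₀ : ∀ i, 0 < r₀ i)
    (hdom : ∀ i, Reach.bihariArg (fun s => w i s (2 * δ + ε)) (a i) (b i) (r₀ i) t₀ tf κ ∈
      Reach.bihariG (fun s => w i s (2 * δ + ε)) (r₀ i) '' Set.Ioi 0) :
    (∀ x₀ ∈ X₀, ∃ y₀ ∈ Y₀, ‖x₀ - y₀‖ ≤ κ ∧ ∃ x y : ℝ → Reach.Euc n,
      Reach.IsTrajectory (Reach.velocitySet f U) t₀ x ∧ x t₀ = x₀ ∧
      Reach.IsTrajectory (Reach.velocitySet g V) t₀ y ∧ y t₀ = y₀ ∧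
      ∀ t ∈ Set.Icc t₀ tf, ∀ i,
        |x t i - y t i| ≤ Reach.eta a b w r₀ t₀ t (2 * δ + ε) κ i) ∧
    (∀ t ∈ Set.Icc t₀ tf, ∀ i,
      Reach.boxDist (Reach.reachableSet (Reach.velocitySet g V) t₀ Y₀ t)
        (Reach.reachableSet (Reach.velocitySet f U) t₀ X₀ t) i ≤
          ENNReal.ofReal (Reach.eta a b w r₀ t₀ tf (2 * δ + ε) κ i)) ∧
    (∀ t ∈ Set.Icc t₀ tf,
      Reach.reachableSet (Reach.velocitySet g V) t₀ Y₀ t ⊆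
        Reach.boxFattening (Reach.reachableSet (Reach.velocitySet f U) t₀ X₀ t)
          (Reach.eta a b w r₀ t₀ tf (2 * δ + ε) κ)) := by
  have hδ' : ∀ u ∈ U, ‖u‖ ≤ δ := fun u hu => hδ.2 ⟨u, hu, rfl⟩
  have hUV' : ∀ u ∈ U, ∀ v ∈ V, ‖u - v‖ ≤ 2 * δ + ε := fun u hu v hv =>
    Reach.norm_sub_le_of_infDist_le hδ' hu (hUV v hv)
  -- No sign of `ε` is assumed; an actual pair of controls gives the bound, with `V` nonempty
  -- because the values of the off-nominal multifunction are.
  have hc : 0 ≤ 2 * δ + ε := by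
    obtain ⟨u, hu, -⟩ := hδ.1
    obtain ⟨-, v, hv, -⟩ := (hG.isPathConnected t₀ ht₀ 0).nonempty
    exact (norm_nonneg _).trans (hUV' u hu v hv)
  have hY : ∀ x₀ ∈ X₀, ∃ y₀ ∈ Y₀, ‖x₀ - y₀‖ ≤ κ := fun x₀ hx₀ =>
    Reach.exists_norm_sub_le_of_hausdorffEDist_le hκ hY₀ hY₀'.nonempty hXY hx₀
  have hX : ∀ y₀ ∈ Y₀, ∃ x₀ ∈ X₀, ‖y₀ - x₀‖ ≤ κ := fun y₀ hy₀ =>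
    Reach.exists_norm_sub_le_of_hausdorffEDist_le hκ hX₀.isClosed hX₀'.nonempty
      (by rwa [Metric.hausdorffEDist_comm]) hy₀
  -- the deviation of any two trajectories with close initial states
  have hdev : ∀ x y : ℝ → Reach.Euc n, Reach.IsTrajectory (Reach.velocitySet f U) t₀ x →
      x t₀ ∈ X₀ → Reach.IsTrajectory (Reach.velocitySet g V) t₀ y → y t₀ ∈ Y₀ →
      ‖x t₀ - y t₀‖ ≤ κ → ∀ t ∈ Set.Icc t₀ tf, ∀ i,
      |x t i - y t i| ≤ Reach.eta a b w r₀ t₀ t (2 * δ + ε) κ i :=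
    fun x y hx hx₀ hy hy₀ hxy t ht i =>
      Reach.abs_sub_le_eta hc hUV' hκ hdata hgrowth hr₀ hdom hx hx₀ hy hy₀ hxy ht i
  have hfinal : ∀ t ∈ Set.Icc t₀ tf, ∀ i, Reach.eta a b w r₀ t₀ t (2 * δ + ε) κ i ≤
      Reach.eta a b w r₀ t₀ tf (2 * δ + ε) κ i := fun t ht i =>
    Reach.eta_le_eta_final hdata hc hκ hr₀ hdom htf i ht
  -- Shared by one half of (ii) and by (iii): any nominal trajectory from a `κ`-close initial state
  -- serves as the companion of `y`.
  have hback : ∀ y : ℝ → Reach.Euc n, Reach.IsTrajectory (Reach.velocitySet g V) t₀ y →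
      y t₀ ∈ Y₀ → ∀ t ∈ Set.Icc t₀ tf,
      ∃ p ∈ Reach.reachableSet (Reach.velocitySet f U) t₀ X₀ t, ∀ i,
        |y t i - p i| ≤ Reach.eta a b w r₀ t₀ tf (2 * δ + ε) κ i := by
    intro y hy hy₀ t ht
    obtain ⟨x₀, hx₀, hxy⟩ := hX _ hy₀
    obtain ⟨x, hx, rfl⟩ := hF.exists_trajectory ht₀ x₀
    refine ⟨x t, ⟨x, hx, hx₀, rfl⟩, fun i => ?_⟩
    rw [abs_sub_comm]
    exact (hdev x y hx hx₀ hy hy₀ (by rwa [norm_sub_rev]) t ht i).trans (hfinal t ht i)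
  refine ⟨?_, ?_, ?_⟩
  · intro x₀ hx₀
    obtain ⟨y₀, hy₀, hxy⟩ := hY x₀ hx₀
    obtain ⟨x, hx, rfl⟩ := hF.exists_trajectory ht₀ x₀
    obtain ⟨y, hy, rfl⟩ := hG.exists_trajectory ht₀ y₀
    exact ⟨_, hy₀, hxy, x, y, hx, rfl, hy, rfl, hdev x y hx hx₀ hy hy₀ hxy⟩
  · intro t ht i
    refine max_le (iSup₂_le ?_) (iSup₂_le ?_)
    · rintro - ⟨y, hy, hy₀, rfl⟩
      obtain ⟨p, hp, hyp⟩ := hback y hy hy₀ t ht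
      exact Reach.axisDist_le_of_mem hp (hyp i)
    · rintro - ⟨x, hx, hx₀, rfl⟩
      obtain ⟨y₀, hy₀, hxy⟩ := hY _ hx₀
      obtain ⟨y, hy, rfl⟩ := hG.exists_trajectory ht₀ y₀
      have hyt : y t ∈ Reach.reachableSet (Reach.velocitySet g V) t₀ Y₀ t := ⟨y, hy, hy₀, rfl⟩
      exact Reach.axisDist_le_of_mem hyt
        ((hdev x y hx hx₀ hy hy₀ hxy t ht i).trans (hfinal t ht i))
  · rintro t ht - ⟨y, hy, hy₀, rfl⟩
    obtain ⟨p, hp, hyp⟩ := hback y hy hy₀ t ht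
    exact Set.mem_iUnion₂.2 ⟨p, hp, fun i => abs_le.1 (hyp i)⟩
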